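/- Let $N\ge 1$, let $\Omega\subset\mathbb{R}^N$ be a bounded domain (non-empty, open, connected) with Lipschitz boundary, and let $g:\partial\Omega\to\mathbb{R}$ be such that $$S:=\{u\in H^1(\Omega): u\ge 0 \text{ a.e. in } \Omega,\ u|_{\partial\Omega}=g\}\neq\varnothing ,$$ where $u|_{\partial\Omega}\in L^2(\partial\Omega)$ denotes the trace of $u$ (equalities of traces hold almost everywhere with respect to the surface measure on $\partial\Omega$). Then for every $f\in L^2(\Omega)$ the energy $$I(u):=\frac12\int_\Omega|\nabla u|^2\,dx-\int_\Omega f\,u^+\,dx,\qquad u^+:=\max\{u,0\},$$ has a unique minimizer over $S$: there is exactly one $u\in S$ (as an element of $H^1(\Omega)$) such that $I(u)\le I(v)$ for all $v\in S$. -/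

import Mathlib

open MeasureTheory Filter Topology
open scoped ContDiff InnerProductSpace

noncomputable section

namespace ObstacleEnergy

/-- Euclidean space `ℝ^N`. -/
abbrev E (N : ℕ) : Type := EuclideanSpace ℝ (Fin N)

/-- The space `L²(Ω; F)` (with respect to Lebesgue measure). -/
abbrev L2 {N : ℕ} (Ω : Set (E N)) (F : Type) [NormedAddCommGroup F] : Type :=
  Lp F 2 (volume.restrict Ω)

/-- `Ω` has Lipschitz boundary: near each boundary point, after choosing a unit vector `e` as the
"vertical" direction, `Ω` is the part of the space strictly above the graph of a Lipschitz function
defined on the hyperplane orthogonal to `e`. -/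
def HasLipschitzBoundary {N : ℕ} (Ω : Set (E N)) : Prop :=
  ∀ x₀ ∈ frontier Ω, ∃ r > 0, ∃ e : E N, ‖e‖ = 1 ∧
    ∃ (K : NNReal) (γ : (Submodule.span ℝ {e})ᗮ → ℝ), LipschitzWith K γ ∧
      ∀ x ∈ Metric.ball x₀ r,
        x ∈ Ω ↔ γ ((Submodule.span ℝ {e})ᗮ.orthogonalProjectionOnto x) < ⟪e, x⟫_ℝ

/-- A bounded domain (non-empty connected open set) with Lipschitz boundary. -/
structure IsBoundedLipschitzDomain {N : ℕ} (Ω : Set (E N)) : Prop where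
  isOpen : IsOpen Ω
  isConnected : IsConnected Ω
  isBounded : Bornology.IsBounded Ω
  lipschitz : HasLipschitzBoundary Ω

/-- Test functions `φ ∈ C_c^∞(Ω)`. -/
structure IsTestFunction {N : ℕ} (Ω : Set (E N)) (φ : E N → ℝ) : Prop where
  smooth : ContDiff ℝ ∞ φ
  compactSupport : HasCompactSupport φ
  support_subset : tsupport φ ⊆ Ω

/-- `G ∈ L²(Ω; ℝ^N)` is the weak gradient of `u ∈ L²(Ω)`:
`∫_Ω u ∂ᵢφ = - ∫_Ω Gᵢ φ` for all `i` and all `φ ∈ C_c^∞(Ω)`. -/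
def IsWeakGradient {N : ℕ} (Ω : Set (E N)) (u : L2 Ω ℝ) (G : L2 Ω (E N)) : Prop :=
  ∀ φ : E N → ℝ, IsTestFunction Ω φ → ∀ i : Fin N,
    ∫ x in Ω, u x * fderiv ℝ φ x (EuclideanSpace.single i 1) = - ∫ x in Ω, G x i * φ x

/-- The Sobolev space `H¹(Ω)`, as a set of elements of `L²(Ω)`. -/
def H1 {N : ℕ} (Ω : Set (E N)) : Set (L2 Ω ℝ) :=
  {u | ∃ G : L2 Ω (E N), IsWeakGradient Ω u G}

/-- On an open set the weak gradient is unique. -/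
theorem IsWeakGradient.unique {N : ℕ} {Ω : Set (E N)} (hΩ : IsOpen Ω) {u : L2 Ω ℝ}
    {G G' : L2 Ω (E N)} (h : IsWeakGradient Ω u G) (h' : IsWeakGradient Ω u G') : G = G' := by
  have key : ∀ i : Fin N, ∀ᵐ x ∂(volume : Measure (E N)), x ∈ Ω → G x i - G' x i = 0 := by
    intro i
    have hm : ∀ H : L2 Ω (E N), MemLp (fun x => H x i) 2 (volume.restrict Ω) := fun H =>
      (EuclideanSpace.proj (𝕜 := ℝ) i).comp_memLp' (Lp.memLp H)
    have hloc : ∀ H : L2 Ω (E N), LocallyIntegrable (fun x => H x i) (volume.restrict Ω) :=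
      fun H => (hm H).locallyIntegrable (by norm_num)
    have hlocOn : LocallyIntegrableOn (fun x => G x i - G' x i) Ω volume := by
      rw [locallyIntegrableOn_iff hΩ.isLocallyClosed]
      intro k hk hkc
      have := (((hloc G).sub (hloc G')).integrableOn_isCompact hkc)
      rw [IntegrableOn, Measure.restrict_restrict hkc.measurableSet,
        Set.inter_eq_left.2 hk] at this
      exact this
    refine hΩ.ae_eq_zero_of_integral_contDiff_smul_eq_zero hlocOn ?_
    intro φ hφ hc hs
    have hφ2 : MemLp φ 2 (volume.restrict Ω) :=
      (hφ.continuous.memLp_of_hasCompactSupport hc).restrict Ω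
    have hi : ∀ H : L2 Ω (E N), Integrable (fun x => H x i * φ x) (volume.restrict Ω) :=
      fun H => (hm H).integrable_mul hφ2
    have e1 := h φ ⟨hφ, hc, hs⟩ i
    have e2 := h' φ ⟨hφ, hc, hs⟩ i
    have e3 : ∫ x in Ω, φ x • (G x i - G' x i) = 0 := by
      have : (fun x => φ x • (G x i - G' x i)) = fun x => G x i * φ x - G' x i * φ x := by
        funext x
        simp only [smul_eq_mul]
        ring
      rw [this, integral_sub (hi G) (hi G')]
      linarith
    rw [← e3, setIntegral_eq_integral_of_forall_compl_eq_zero]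
    intro x hx
    have : φ x = 0 := by
      by_contra hne
      exact hx (hs (subset_tsupport φ hne))
    simp [this]
  refine Lp.ext ?_
  have : ∀ᵐ x ∂(volume.restrict Ω), ∀ i, G x i - G' x i = 0 := by
    rw [ae_all_iff]
    intro i
    exact (ae_restrict_iff' hΩ.measurableSet).2 (key i)
  filter_upwards [this] with x hx
  ext i
  exact sub_eq_zero.1 (hx i)

open Classical in
/-- The weak gradient `∇u` of `u ∈ H¹(Ω)` (and `0` when `u ∉ H¹(Ω)`). -/
def weakGradient {N : ℕ} (Ω : Set (E N)) (u : L2 Ω ℝ) : L2 Ω (E N) :=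
  if h : ∃ G : L2 Ω (E N), IsWeakGradient Ω u G then h.choose else 0

/-- The surface measure on `∂Ω`: the `(N-1)`-dimensional Hausdorff measure, normalised so that it
agrees with Lebesgue measure on `(N-1)`-dimensional subspaces. -/
def surfaceMeasure {N : ℕ} (Ω : Set (E N)) : Measure (frontier Ω) :=
  (Measure.euclideanHausdorffMeasure (N - 1) : Measure (E N)).comap Subtype.val

/-- `g ∈ L²(∂Ω)` is the trace `u|_{∂Ω}` of `u ∈ H¹(Ω)`. The trace operator of a bounded Lipschitz
domain is the continuous extension to `H¹(Ω)` of the restriction `φ ↦ φ|_{∂Ω} ∈ L²(∂Ω)`, defined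
for functions `φ` that are smooth up to the boundary; so `g` is the trace of `u` when some such
functions `φₙ` satisfy `φₙ → u` in `H¹(Ω)` and `φₙ|_{∂Ω} → g` in `L²(∂Ω)`. -/
def HasTrace {N : ℕ} (Ω : Set (E N)) (u : L2 Ω ℝ) (g : frontier Ω → ℝ) : Prop :=
  MemLp g 2 (surfaceMeasure Ω) ∧
    ∃ φ : ℕ → E N → ℝ, (∀ n, ContDiff ℝ ∞ (φ n)) ∧
      Tendsto (fun n => eLpNorm (fun x => φ n x - u x) 2 (volume.restrict Ω)) atTop (𝓝 0) ∧
      Tendsto (fun n => eLpNorm (fun x => gradient (φ n) x - weakGradient Ω u x) 2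
        (volume.restrict Ω)) atTop (𝓝 0) ∧
      Tendsto (fun n => eLpNorm (fun y : frontier Ω => φ n y - g y) 2 (surfaceMeasure Ω))
        atTop (𝓝 0)

/-- The admissible class `S = {u ∈ H¹(Ω) : u ≥ 0 a.e. in Ω, u|_{∂Ω} = g}`. -/
def admissible {N : ℕ} (Ω : Set (E N)) (g : frontier Ω → ℝ) : Set (L2 Ω ℝ) :=
  {u | u ∈ H1 Ω ∧ (∀ᵐ x ∂(volume.restrict Ω), 0 ≤ u x) ∧ HasTrace Ω u g}

/-- The energy `I(u) = ½ ∫_Ω |∇u|² dx - ∫_Ω f u⁺ dx`. -/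
def energy {N : ℕ} (Ω : Set (E N)) (f : E N → ℝ) (u : L2 Ω ℝ) : ℝ :=
  (1 / 2) * (∫ x in Ω, ‖weakGradient Ω u x‖ ^ 2) - ∫ x in Ω, f x * max (u x) 0

end ObstacleEnergy

end

/-! On the admissible class `u⁺ = u`, so the energy is half the squared norm of the gradient minus a
linear functional. Treat `(u, ∇u)` as a point of `L²(Ω) × L²(Ω; ℝ^N)`: the admissible pairs form a
closed convex set (`isClosed_admissiblePairs`, `convex_admissiblePairs`). The energy is strictly
convex only in the gradient, but two admissible functions differ by one of zero trace, so the
gradient controls the function (`exists_norm_sub_le`). The parallelogram law then makes minimizing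
sequences Cauchy in norm and gives uniqueness (`existsUnique_minimizer`); no weak compactness is
needed.

The analytic input is Friedrichs' inequality with a boundary term for smooth functions
(`exists_eLpNorm_le`). Integrate the gradient from `x` along a fixed direction to the first exit
from `Ω`; the exit map pushes Lebesgue measure on `Ω` to at most a multiple of surface measure
(`map_exitPoint_le`). -/

noncomputable section

namespace ObstacleEnergy

/-! ### Friedrichs' inequality by following parallel lines to the boundary -/

section Friedrichs

theorem sq_lintegral_Ioc_le {T : ℝ} {h : ℝ → ENNReal} (hh : AEMeasurable h) :
    (∫⁻ s in Set.Ioc 0 T, h s) ^ 2 ≤ ENNReal.ofReal T * ∫⁻ s in Set.Ioc 0 T, h s ^ 2 := by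
  have := ENNReal.lintegral_mul_le_Lp_mul_Lq (volume.restrict (Set.Ioc 0 T))
    Real.HolderConjugate.two_two (f := fun _ => 1) (g := h) aemeasurable_const hh.restrict
  simp only [Pi.mul_apply, one_mul, ENNReal.rpow_ofNat] at this
  refine (pow_le_pow_left₀ (zero_le) this 2).trans ?_
  rw [mul_pow, ← ENNReal.rpow_mul_natCast, ← ENNReal.rpow_mul_natCast]
  norm_num

variable {V : Type*} [NormedAddCommGroup V] [InnerProductSpace ℝ V]

/-- The first time at which the half-line from `x` in direction `-e` is outside `Ω`. -/
def exitTime (Ω : Set V) (e x : V) : ℝ := sInf {s : ℝ | 0 ≤ s ∧ x - s • e ∉ Ω}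

/-- The first point outside `Ω` on the half-line from `x` in direction `-e`. -/
def exitPoint (Ω : Set V) (e x : V) : V := x - exitTime Ω e x • e

variable {Ω : Set V} {e : V}

theorem exists_exit (hb : Bornology.IsBounded Ω) (he : ‖e‖ = 1) (x : V) :
    ∃ s : ℝ, 0 ≤ s ∧ x - s • e ∉ Ω := by
  obtain ⟨R, hR⟩ := hb.subset_closedBall 0
  -- After this time the point has norm at least `|R| + 1`, hence lies outside the ball containing
  -- `Ω`.
  refine ⟨‖x‖ + |R| + 1, by positivity, fun h => ?_⟩
  have h1 : ‖x - (‖x‖ + |R| + 1) • e‖ ≤ R := by simpa using hR h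
  have h2 : ‖(‖x‖ + |R| + 1) • e‖ = ‖x‖ + |R| + 1 := by
    rw [norm_smul, he, mul_one, Real.norm_of_nonneg (by positivity)]
  have h3 := norm_sub_norm_le ((‖x‖ + |R| + 1) • e) x
  rw [norm_sub_rev] at h3
  linarith [le_abs_self R]

theorem exitTime_mem (ho : IsOpen Ω) (hb : Bornology.IsBounded Ω) (he : ‖e‖ = 1) (x : V) :
    0 ≤ exitTime Ω e x ∧ exitPoint Ω e x ∉ Ω := by
  have hc : IsClosed {s : ℝ | 0 ≤ s ∧ x - s • e ∉ Ω} := by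
    refine isClosed_Ici.inter (?_ : IsClosed ((fun s : ℝ => x - s • e) ⁻¹' Ωᶜ))
    exact ho.isClosed_compl.preimage (by fun_prop)
  exact hc.csInf_mem (exists_exit hb he x) ⟨0, fun s hs => hs.1⟩

theorem mem_of_lt_exitTime {x : V} {s : ℝ} (h0 : 0 ≤ s) (hs : s < exitTime Ω e x) :
    x - s • e ∈ Ω := by
  by_contra h
  have hle : exitTime Ω e x ≤ s := csInf_le ⟨0, fun s hs => hs.1⟩ ⟨h0, h⟩
  exact absurd hle (not_le.2 hs)

theorem exitPoint_mem_frontier (ho : IsOpen Ω) (hb : Bornology.IsBounded Ω) (he : ‖e‖ = 1)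
    {x : V} (hx : x ∈ Ω) : exitPoint Ω e x ∈ frontier Ω := by
  obtain ⟨h0, h1⟩ := exitTime_mem ho hb he x
  rw [ho.frontier_eq]
  refine ⟨?_, h1⟩
  have hpos : 0 < exitTime Ω e x := by
    rcases h0.eq_or_lt with h | h
    · simp [exitPoint, ← h, hx] at h1
    · exact h
  have hcl : exitTime Ω e x ∈ closure (Set.Ico 0 (exitTime Ω e x)) := by
    rw [closure_Ico hpos.ne]
    exact ⟨h0, le_rfl⟩
  have hcont : Continuous (fun s : ℝ => x - s • e) := by fun_prop
  exact map_mem_closure (f := fun s : ℝ => x - s • e) hcont hcl fun s hs => mem_of_lt_exitTime hs.1 hs.2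

theorem exitTime_le {R : ℝ} (hR : Ω ⊆ Metric.closedBall 0 R) (ho : IsOpen Ω) (he : ‖e‖ = 1)
    {x : V} (hx : x ∈ Ω) : exitTime Ω e x ≤ 2 * R := by
  have hb : Bornology.IsBounded Ω := Metric.isBounded_closedBall.subset hR
  have hcl : closure Ω ⊆ Metric.closedBall 0 R := closure_minimal hR Metric.isClosed_closedBall
  have h1 := hcl (exitPoint_mem_frontier ho hb he hx).1
  have h2 := hR hx
  have h0 := (exitTime_mem ho hb he x).1
  simp only [mem_closedBall_zero_iff] at h1 h2
  have h3 : ‖exitTime Ω e x • e‖ = exitTime Ω e x := by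
    rw [norm_smul, he, mul_one, Real.norm_of_nonneg h0]
  have h4 : exitTime Ω e x • e = x - exitPoint Ω e x := by simp [exitPoint]
  have := norm_sub_le x (exitPoint Ω e x)
  rw [← h4, h3] at this
  linarith

/-- Fundamental theorem of calculus on the segment to the exit point. Its interior lies in `Ω`,
whence the indicator; the time range is enlarged to `2 * R`, independent of `x`, so that Tonelli
applies later. -/
theorem enorm_le_exitPoint_add [CompleteSpace V] {R : ℝ} (hR : Ω ⊆ Metric.closedBall 0 R) (ho : IsOpen Ω)
    (he : ‖e‖ = 1) {φ : V → ℝ} (hφ : ContDiff ℝ 1 φ) {x : V} (hx : x ∈ Ω) :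
    ‖φ x‖ₑ ≤ ‖φ (exitPoint Ω e x)‖ₑ +
      ∫⁻ s in Set.Ioc 0 (2 * R), Ω.indicator (fun y => ‖gradient φ y‖ₑ) (x - s • e) := by
  have hb : Bornology.IsBounded Ω := Metric.isBounded_closedBall.subset hR
  set t := exitTime Ω e x
  have h0 : 0 ≤ t := (exitTime_mem ho hb he x).1
  have hd : ∀ s : ℝ, HasDerivAt (fun s : ℝ => φ (x - s • e)) (fderiv ℝ φ (x - s • e) (-e)) s := by
    intro s
    have h1 : HasDerivAt (fun s : ℝ => x - s • e) (-e) s := by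
      simpa using ((hasDerivAt_id s).smul_const e).const_sub x
    exact ((hφ.differentiable one_ne_zero).differentiableAt.hasFDerivAt).comp_hasDerivAt s h1
  have hcont : Continuous fun s : ℝ => fderiv ℝ φ (x - s • e) (-e) :=
    ((hφ.continuous_fderiv one_ne_zero).comp (by fun_prop)).clm_apply continuous_const
  have hint := intervalIntegral.integral_eq_sub_of_hasDerivAt (a := 0) (b := t)
    (fun s _ => hd s) (hcont.intervalIntegrable _ _)
  have hsplit : φ x = φ (exitPoint Ω e x) - ∫ s in Set.Ioo 0 t, fderiv ℝ φ (x - s • e) (-e) := by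
    rw [← integral_Ioc_eq_integral_Ioo, ← intervalIntegral.integral_of_le h0, hint]
    simp [exitPoint, t]
  rw [hsplit]
  refine enorm_sub_le.trans ?_
  gcongr
  refine (enorm_integral_le_lintegral_enorm _).trans ?_
  refine le_trans (setLIntegral_mono' measurableSet_Ioo fun s hs => ?_)
    (lintegral_mono_set fun s hs => ⟨hs.1, hs.2.le.trans (exitTime_le hR ho he hx)⟩)
  rw [Set.indicator_of_mem (mem_of_lt_exitTime hs.1.le hs.2)]
  rw [enorm_le_iff_norm_le]
  refine (ContinuousLinearMap.le_opNorm _ _).trans ?_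
  simp [gradient, he]

variable [MeasurableSpace V] [BorelSpace V]

open scoped Pointwise in
theorem measurable_exitTime (ho : IsOpen Ω) (hb : Bornology.IsBounded Ω) (he : ‖e‖ = 1) :
    Measurable (exitTime Ω e) := by
  refine measurable_of_Iic fun a => IsClosed.measurableSet ?_
  -- Sublevel sets are compact segment plus closed complement, hence closed.
  have h : exitTime Ω e ⁻¹' Set.Iic a = (fun s : ℝ => s • e) '' Set.Icc 0 a + Ωᶜ := by
    ext x
    simp only [Set.mem_preimage, Set.mem_Iic, Set.mem_add, Set.mem_image]
    constructor
    · intro hx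
      obtain ⟨h0, h1⟩ := exitTime_mem ho hb he x
      exact ⟨_, ⟨_, ⟨h0, hx⟩, rfl⟩, _, h1, by simp [exitPoint]⟩
    · rintro ⟨_, ⟨s, hs, rfl⟩, y, hy, rfl⟩
      refine le_trans (csInf_le ⟨0, fun s hs => hs.1⟩ ⟨hs.1, ?_⟩) hs.2
      simpa using hy
  rw [h]
  exact ho.isClosed_compl.add_left_of_isCompact (isCompact_Icc.image (by fun_prop))

theorem measurable_exitPoint [SecondCountableTopology V]
    (ho : IsOpen Ω) (hb : Bornology.IsBounded Ω) (he : ‖e‖ = 1) :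
    Measurable (exitPoint Ω e) :=
  measurable_id.sub ((measurable_exitTime ho hb he).smul_const e)

variable [FiniteDimensional ℝ V]

/-- The part of a ball lying over a set `B` has volume controlled by the measure of the orthogonal
projection of `B` to a hyperplane. -/
theorem volume_closedBall_inter_preimage_le (e : V) (R : ℝ) (B : Set (ℝ ∙ e)ᗮ) :
    volume (Metric.closedBall (0 : V) R ∩ (ℝ ∙ e)ᗮ.orthogonalProjectionOnto ⁻¹' B) ≤
      volume (Metric.closedBall (0 : (ℝ ∙ e)) R) * volume B := by
  have hmp := (ℝ ∙ e).measurePreserving_measurableEquivProd (0 : V)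
  rw [InnerProductSpace.euclideanHausdorffMeasure_eq_volume] at hmp
  rw [← Measure.prod_prod, ← Measure.volume_eq_prod, ← hmp.measure_preimage_equiv]
  refine measure_mono fun x hx => ?_
  simp only [Set.mem_preimage, Submodule.measurableEquivProd_apply, Set.mem_prod, vsub_eq_sub,
    sub_zero]
  refine ⟨?_, hx.2⟩
  rw [mem_closedBall_zero_iff]
  exact ((ℝ ∙ e).norm_orthogonalProjectionOnto_apply_le x).trans
    (mem_closedBall_zero_iff.1 hx.1)

/-- Orthogonal projection is 1-Lipschitz, so it does not increase Hausdorff measure, which on the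
hyperplane is Lebesgue measure. -/
theorem volume_image_orthogonalProjectionOnto_le (he : e ≠ 0) (A : Set V) :
    volume ((ℝ ∙ e)ᗮ.orthogonalProjectionOnto '' A) ≤
      Measure.euclideanHausdorffMeasure (Module.finrank ℝ V - 1) A := by
  have hrank : Module.finrank ℝ (ℝ ∙ e)ᗮ = Module.finrank ℝ V - 1 := by
    have := (ℝ ∙ e).finrank_add_finrank_orthogonal
    rw [finrank_span_singleton he] at this
    omega
  rw [← InnerProductSpace.euclideanHausdorffMeasure_eq_volume, hrank]
  simp only [Measure.euclideanHausdorffMeasure_def, Measure.smul_apply]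
  gcongr
  simpa using (ℝ ∙ e)ᗮ.lipschitzWith_orthogonalProjectionOnto.hausdorffMeasure_image_le
    (Nat.cast_nonneg (Module.finrank ℝ V - 1)) A

/-- Moving along `e` does not change the projection to the hyperplane, so the points exiting through
`A` lie in a bounded cylinder over the projection of `A ∩ frontier Ω`. -/
theorem map_exitPoint_le {R : ℝ} (hR : Ω ⊆ Metric.closedBall 0 R) (ho : IsOpen Ω)
    (he : ‖e‖ = 1) :
    (volume.restrict Ω).map (exitPoint Ω e) ≤
      volume (Metric.closedBall (0 : (ℝ ∙ e)) R) •
        (Measure.euclideanHausdorffMeasure (Module.finrank ℝ V - 1)).restrict (frontier Ω) := by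
  have hb : Bornology.IsBounded Ω := Metric.isBounded_closedBall.subset hR
  have he0 : e ≠ 0 := by rintro rfl; simp at he
  refine Measure.le_iff.2 fun A hA => ?_
  rw [Measure.map_apply (measurable_exitPoint ho hb he) hA,
    Measure.restrict_apply (measurable_exitPoint ho hb he hA), Measure.smul_apply,
    Measure.restrict_apply hA, smul_eq_mul]
  set π := (ℝ ∙ e)ᗮ.orthogonalProjectionOnto
  refine le_trans (measure_mono ?_) ((volume_closedBall_inter_preimage_le e R
    (π '' (A ∩ frontier Ω))).trans ?_)
  · rintro x ⟨hxA, hx⟩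
    refine ⟨hR hx, exitPoint Ω e x, ⟨hxA, exitPoint_mem_frontier ho hb he hx⟩, ?_⟩
    have : π e = 0 := by
      refine Submodule.orthogonalProjectionOnto_apply_of_mem_orthogonal ?_
      simp
    change π (x - exitTime Ω e x • e) = π x
    rw [map_sub, map_smul, this, smul_zero, sub_zero]
  · gcongr
    exact volume_image_orthogonalProjectionOnto_le he0 _

theorem lintegral_sq_le {R : ℝ} (hR : Ω ⊆ Metric.closedBall 0 R) (ho : IsOpen Ω)
    (he : ‖e‖ = 1) {φ : V → ℝ} (hφ : ContDiff ℝ 1 φ) :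
    ∫⁻ x in Ω, ‖φ x‖ₑ ^ 2 ≤
      2 * volume (Metric.closedBall (0 : (ℝ ∙ e)) R) *
        (∫⁻ y in frontier Ω, ‖φ y‖ₑ ^ 2
          ∂(Measure.euclideanHausdorffMeasure (Module.finrank ℝ V - 1))) +
      2 * ENNReal.ofReal (2 * R) ^ 2 * ∫⁻ x in Ω, ‖gradient φ x‖ₑ ^ 2 := by
  have hb : Bornology.IsBounded Ω := Metric.isBounded_closedBall.subset hR
  have hmp := measurable_exitPoint ho hb he
  have hφm : Measurable fun y => ‖φ y‖ₑ ^ 2 := (hφ.continuous.enorm.measurable).pow_const 2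
  have hgm : Measurable fun y => Ω.indicator (fun y => ‖gradient φ y‖ₑ) y := by
    refine Measurable.indicator ?_ ho.measurableSet
    have : Continuous (gradient φ) := by
      unfold gradient
      exact (LinearIsometryEquiv.continuous _).comp (hφ.continuous_fderiv one_ne_zero)
    exact this.enorm.measurable
  set H : V → ENNReal := fun y => Ω.indicator (fun y => ‖gradient φ y‖ₑ) y with hH
  have hpt : ∀ x ∈ Ω, ‖φ x‖ₑ ^ 2 ≤ 2 * ‖φ (exitPoint Ω e x)‖ₑ ^ 2 +
      2 * ENNReal.ofReal (2 * R) * ∫⁻ s in Set.Ioc 0 (2 * R), H (x - s • e) ^ 2 := by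
    intro x hx
    refine (pow_le_pow_left₀ (zero_le) (enorm_le_exitPoint_add hR ho he hφ hx) 2).trans ?_
    have h2 : ∀ a b : ENNReal, (a + b) ^ 2 ≤ 2 * a ^ 2 + 2 * b ^ 2 := fun a b => by
      have := ENNReal.rpow_add_le_mul_rpow_add_rpow a b (p := 2) (by norm_num)
      norm_num at this
      rwa [mul_add] at this
    refine (h2 _ _).trans ?_
    rw [mul_assoc 2 (ENNReal.ofReal _)]
    gcongr
    exact sq_lintegral_Ioc_le (hgm.comp (by fun_prop)).aemeasurable
  have hHs : ∫⁻ x, H x ^ 2 = ∫⁻ x in Ω, ‖gradient φ x‖ₑ ^ 2 := by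
    rw [← lintegral_indicator ho.measurableSet]
    congr 1 with x
    by_cases hx : x ∈ Ω <;> simp [hH, hx]
  calc ∫⁻ x in Ω, ‖φ x‖ₑ ^ 2
      ≤ ∫⁻ x in Ω, (2 * ‖φ (exitPoint Ω e x)‖ₑ ^ 2 +
        2 * ENNReal.ofReal (2 * R) * ∫⁻ s in Set.Ioc 0 (2 * R), H (x - s • e) ^ 2) :=
        setLIntegral_mono' ho.measurableSet hpt
    _ = 2 * (∫⁻ x in Ω, ‖φ (exitPoint Ω e x)‖ₑ ^ 2) + 2 * ENNReal.ofReal (2 * R) *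
          ∫⁻ x in Ω, ∫⁻ s in Set.Ioc 0 (2 * R), H (x - s • e) ^ 2 := by
        have hm : Measurable fun x => ‖φ (exitPoint Ω e x)‖ₑ ^ 2 := hφm.comp hmp
        rw [lintegral_add_left (hm.const_mul 2), lintegral_const_mul _ hm, lintegral_const_mul']
        exact ENNReal.mul_ne_top (by simp) ENNReal.ofReal_ne_top
    _ ≤ 2 * (volume (Metric.closedBall (0 : (ℝ ∙ e)) R) * (∫⁻ y in frontier Ω, ‖φ y‖ₑ ^ 2
          ∂(Measure.euclideanHausdorffMeasure (Module.finrank ℝ V - 1)))) +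
        2 * ENNReal.ofReal (2 * R) *
          (ENNReal.ofReal (2 * R) * ∫⁻ x in Ω, ‖gradient φ x‖ₑ ^ 2) := by
        gcongr
        · rw [← lintegral_map hφm hmp, ← smul_eq_mul, ← lintegral_smul_measure]
          exact lintegral_mono' (map_exitPoint_le hR ho he) le_rfl
        -- Over the whole space each shift by `s • e` preserves the integral; integrating in `s`
        -- yields the second factor `2 * R`.
        · refine (setLIntegral_le_lintegral _ _).trans ?_
          rw [lintegral_lintegral_swap]
          · simp_rw [lintegral_sub_right_eq_self (fun x => H x ^ 2), hHs]
            simp [mul_comm]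
          · exact ((hgm.comp (by fun_prop)).pow_const 2).aemeasurable
    _ = _ := by ring

end Friedrichs

/-- Friedrichs' inequality. -/
theorem exists_eLpNorm_le {N : ℕ} (hN : 1 ≤ N) {Ω : Set (E N)} (ho : IsOpen Ω)
    (hb : Bornology.IsBounded Ω) :
    ∃ C : NNReal, ∀ φ : E N → ℝ, ContDiff ℝ 1 φ →
      eLpNorm φ 2 (volume.restrict Ω) ≤ C * (eLpNorm (gradient φ) 2 (volume.restrict Ω) +
        eLpNorm (fun y : frontier Ω => φ y) 2 (surfaceMeasure Ω)) := by
  obtain ⟨R, hR⟩ := hb.subset_closedBall 0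
  let e : E N := EuclideanSpace.single ⟨0, hN⟩ 1
  have he : ‖e‖ = 1 := by simp [e]
  set A := 2 * volume (Metric.closedBall (0 : (ℝ ∙ e)) R)
  set B := 2 * ENNReal.ofReal (2 * R) ^ 2
  have hA : A ≠ ⊤ := ENNReal.mul_ne_top (by simp) measure_closedBall_lt_top.ne
  have hB : B ≠ ⊤ := ENNReal.mul_ne_top (by simp) (ENNReal.pow_ne_top ENNReal.ofReal_ne_top)
  lift A to NNReal using hA with A' hA'
  lift B to NNReal using hB with B' hB'
  -- The square of this constant dominates both `A'` and `B'`, which avoids square roots.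
  refine ⟨1 + A' + B', fun φ hφ => ?_⟩
  have sq : ∀ {α F : Type} [MeasurableSpace α] [NormedAddCommGroup F] (μ : Measure α) (f : α → F),
      eLpNorm f 2 μ ^ 2 = ∫⁻ x, ‖f x‖ₑ ^ 2 ∂μ := by
    intro α F _ _ μ f
    simpa using eLpNorm_nnreal_pow_eq_lintegral (f := f) (μ := μ) (p := 2) (by norm_num)
  have key := lintegral_sq_le hR ho he hφ
  change _ ≤ A * _ + B * _ at key
  rw [← hA', ← hB', ← lintegral_subtype_comap isClosed_frontier.measurableSet, ← sq, ← sq] at key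
  rw [finrank_euclideanSpace_fin, ← sq] at key
  unfold surfaceMeasure
  refine (ENNReal.pow_le_pow_left_iff two_ne_zero).1 (key.trans ?_)
  generalize eLpNorm (gradient φ) 2 (volume.restrict Ω) = y
  generalize eLpNorm (fun y : frontier Ω => φ y) 2 _ = z
  push_cast
  have h1 : (A' : ENNReal) ≤ (1 + A' + B') ^ 2 := by
    exact_mod_cast (show A' ≤ (1 + A' + B') ^ 2 by
      rw [← NNReal.coe_le_coe]; push_cast
      nlinarith [A'.coe_nonneg, B'.coe_nonneg, mul_nonneg A'.coe_nonneg B'.coe_nonneg])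
  have h2 : (B' : ENNReal) ≤ (1 + A' + B') ^ 2 := by
    exact_mod_cast (show B' ≤ (1 + A' + B') ^ 2 by
      rw [← NNReal.coe_le_coe]; push_cast
      nlinarith [A'.coe_nonneg, B'.coe_nonneg, mul_nonneg A'.coe_nonneg B'.coe_nonneg])
  have h3 : z ^ 2 + y ^ 2 ≤ (y + z) ^ 2 := by
    calc z ^ 2 + y ^ 2 ≤ z ^ 2 + y ^ 2 + 2 * y * z := le_self_add
      _ = _ := by ring
  calc _ ≤ (1 + A' + B' : ENNReal) ^ 2 * z ^ 2 + (1 + A' + B') ^ 2 * y ^ 2 := by gcongr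
    _ = (1 + A' + B' : ENNReal) ^ 2 * (z ^ 2 + y ^ 2) := by ring
    _ ≤ (1 + A' + B' : ENNReal) ^ 2 * (y + z) ^ 2 := by gcongr
    _ = _ := by ring

/-! ### The direct method in a product of Hilbert spaces -/

section DirectMethod

variable {X Y : Type*} [NormedAddCommGroup X] [InnerProductSpace ℝ X] [CompleteSpace X]
  [NormedAddCommGroup Y] [InnerProductSpace ℝ Y] [CompleteSpace Y]

/-- The energy `½‖y‖² - ⟪F, x⟫` has a unique minimizer on a non-empty closed convex set on which
the second component controls the first. -/
theorem existsUnique_minimizer {K : Set (X × Y)} (hne : K.Nonempty) (hcl : IsClosed K)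
    (hconv : Convex ℝ K) {C : ℝ} (hC0 : 0 ≤ C)
    (hC : ∀ p ∈ K, ∀ q ∈ K, ‖p.1 - q.1‖ ≤ C * ‖p.2 - q.2‖) (F : X) :
    ∃! p, p ∈ K ∧ ∀ q ∈ K,
      1 / 2 * ‖p.2‖ ^ 2 - ⟪F, p.1⟫_ℝ ≤ 1 / 2 * ‖q.2‖ ^ 2 - ⟪F, q.1⟫_ℝ := by
  set J : X × Y → ℝ := fun p => 1 / 2 * ‖p.2‖ ^ 2 - ⟪F, p.1⟫_ℝ with hJ
  change ∃! p, p ∈ K ∧ ∀ q ∈ K, J p ≤ J q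
  -- Parallelogram law: the midpoint gains `1 / 8 * ‖p.2 - q.2‖ ^ 2`, the linear term being affine.
  have hmid : ∀ p ∈ K, ∀ q ∈ K, ∃ m ∈ K, J m = (J p + J q) / 2 - 1 / 8 * ‖p.2 - q.2‖ ^ 2 := by
    intro p hp q hq
    refine ⟨(1 / 2 : ℝ) • p + (1 / 2 : ℝ) • q,
      hconv hp hq (by norm_num) (by norm_num) (by norm_num), ?_⟩
    have h1 := parallelogram_law_with_norm ℝ p.2 q.2
    have h2 : ‖(1 / 2 : ℝ) • p.2 + (1 / 2 : ℝ) • q.2‖ = 1 / 2 * ‖p.2 + q.2‖ := by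
      rw [← smul_add, norm_smul]; norm_num
    simp only [hJ, Prod.fst_add, Prod.snd_add, Prod.smul_fst, Prod.smul_snd, h2, inner_add_right,
      inner_smul_right]
    linarith
  obtain ⟨p₀, hp₀⟩ := hne
  -- On `K`, `‖q.1‖` grows at most linearly in `‖q.2‖`, so completing the square bounds `J` below.
  have hbdd : BddBelow (J '' K) := by
    refine ⟨-(‖F‖ * (‖p₀.1‖ + C * ‖p₀.2‖)) - 1 / 2 * (‖F‖ * C) ^ 2, ?_⟩
    rintro _ ⟨q, hq, rfl⟩
    have h1 : ‖q.1‖ ≤ ‖p₀.1‖ + C * (‖q.2‖ + ‖p₀.2‖) := by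
      have a := norm_le_norm_add_norm_sub' q.1 p₀.1
      have b := hC q hq p₀ hp₀
      have c := mul_le_mul_of_nonneg_left (norm_sub_le q.2 p₀.2) hC0
      linarith
    have h2 := real_inner_le_norm F q.1
    have h3 := mul_le_mul_of_nonneg_left h1 (norm_nonneg F)
    simp only [hJ]
    nlinarith [sq_nonneg (‖q.2‖ - ‖F‖ * C)]
  set I := sInf (J '' K)
  have hI : ∀ q ∈ K, I ≤ J q := fun q hq => csInf_le hbdd ⟨q, hq, rfl⟩
  -- The midpoint stays in `K`, so its energy is at least `I`: nearly minimal points have close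
  -- second components.
  have hdist : ∀ p ∈ K, ∀ q ∈ K, ‖p.2 - q.2‖ ^ 2 ≤ 4 * ((J p - I) + (J q - I)) := by
    intro p hp q hq
    obtain ⟨m, hm, hm'⟩ := hmid p hp q hq
    linarith [hI m hm]
  have hdist' : ∀ p ∈ K, ∀ q ∈ K, dist p q ≤ (C + 1) * ‖p.2 - q.2‖ := by
    intro p hp q hq
    rw [Prod.dist_eq, dist_eq_norm, dist_eq_norm]
    refine max_le ((hC p hp q hq).trans ?_) ?_ <;> nlinarith [norm_nonneg (p.2 - q.2)]
  have hseq : ∀ n : ℕ, ∃ p ∈ K, J p < I + 1 / (n + 1) := by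
    intro n
    obtain ⟨_, ⟨p, hp, rfl⟩, h⟩ := exists_lt_of_csInf_lt (⟨_, p₀, hp₀, rfl⟩ : (J '' K).Nonempty)
      (show sInf (J '' K) < I + 1 / ((n : ℝ) + 1) from lt_add_of_pos_right _ (by positivity))
    exact ⟨p, hp, h⟩
  choose p hpK hpJ using hseq
  have hcauchy : CauchySeq p := by
    refine cauchySeq_of_le_tendsto_0 (fun n : ℕ => (C + 1) * √(8 * (1 / ((n : ℝ) + 1)))) ?_ ?_
    · intro n m k hn hm
      refine (hdist' _ (hpK n) _ (hpK m)).trans ?_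
      refine mul_le_mul_of_nonneg_left (Real.le_sqrt_of_sq_le ?_) (by positivity)
      have h1 := hdist _ (hpK n) _ (hpK m)
      have h2 : 1 / ((n : ℝ) + 1) ≤ 1 / ((k : ℝ) + 1) := by gcongr
      have h3 : 1 / ((m : ℝ) + 1) ≤ 1 / ((k : ℝ) + 1) := by gcongr
      linarith [hpJ n, hpJ m]
    · have := ((tendsto_one_div_add_atTop_nhds_zero_nat (𝕜 := ℝ)).const_mul 8).sqrt.const_mul (C + 1)
      simpa using this
  obtain ⟨q, hq⟩ := cauchySeq_tendsto_of_complete hcauchy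
  have hqK : q ∈ K := hcl.mem_of_tendsto hq (Eventually.of_forall hpK)
  have hJc : Continuous J := by fun_prop
  have hqI : J q ≤ I := by
    refine le_of_tendsto_of_tendsto ((hJc.tendsto q).comp hq)
      (tendsto_one_div_add_atTop_nhds_zero_nat.const_add I) (Eventually.of_forall fun n =>
        (hpJ n).le) |>.trans_eq (add_zero I)
  refine ⟨q, ⟨hqK, fun r hr => hqI.trans (hI r hr)⟩, ?_⟩
  rintro r ⟨hr, hr'⟩
  have h1 := hdist r hr q hqK
  have h2 : ‖r.2 - q.2‖ = 0 := by
    have := norm_nonneg (r.2 - q.2)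
    nlinarith [hr' q hqK]
  have h3 := hdist' r hr q hqK
  rw [h2, mul_zero] at h3
  exact dist_le_zero.1 h3

end DirectMethod

/-! ### The weak gradient as a closed linear relation -/

section WeakGradient

variable {N : ℕ} {Ω : Set (E N)}

theorem weakGradient_eq (ho : IsOpen Ω) {u : L2 Ω ℝ} {G : L2 Ω (E N)}
    (h : IsWeakGradient Ω u G) : weakGradient Ω u = G := by
  have hex : ∃ G : L2 Ω (E N), IsWeakGradient Ω u G := ⟨G, h⟩
  rw [weakGradient, dif_pos hex]
  exact hex.choose_spec.unique ho h

theorem isWeakGradient_weakGradient {u : L2 Ω ℝ} (h : u ∈ H1 Ω) :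
    IsWeakGradient Ω u (weakGradient Ω u) := by
  have hex : ∃ G : L2 Ω (E N), IsWeakGradient Ω u G := h
  rw [weakGradient, dif_pos hex]
  exact hex.choose_spec

theorem IsTestFunction.memLp_fderiv {φ : E N → ℝ} (h : IsTestFunction Ω φ) (i : Fin N) :
    MemLp (fun x => fderiv ℝ φ x (EuclideanSpace.single i 1)) 2 (volume.restrict Ω) :=
  (((h.smooth.continuous_fderiv (by simp)).clm_apply continuous_const).memLp_of_hasCompactSupport
    (h.compactSupport.fderiv_apply ℝ _)).restrict Ω

theorem IsTestFunction.memLp_single {φ : E N → ℝ} (h : IsTestFunction Ω φ) (i : Fin N) :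
    MemLp (fun x => φ x • (EuclideanSpace.single i 1 : E N)) 2 (volume.restrict Ω) :=
  ((h.smooth.continuous.smul continuous_const).memLp_of_hasCompactSupport
    h.compactSupport.smul_right).restrict Ω

/-- Written as inner products with fixed `L²` elements, the conditions are continuous and linear in
`(u, G)`. -/
theorem isWeakGradient_iff {u : L2 Ω ℝ} {G : L2 Ω (E N)} :
    IsWeakGradient Ω u G ↔ ∀ φ : E N → ℝ, ∀ h : IsTestFunction Ω φ, ∀ i : Fin N,
      ⟪(h.memLp_fderiv i).toLp, u⟫_ℝ + ⟪(h.memLp_single i).toLp, G⟫_ℝ = 0 := by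
  refine forall₃_congr fun φ h i => ?_
  have h1 : ⟪(h.memLp_fderiv i).toLp, u⟫_ℝ =
      ∫ x in Ω, u x * fderiv ℝ φ x (EuclideanSpace.single i 1) := by
    rw [L2.inner_def]
    refine integral_congr_ae ?_
    filter_upwards [(h.memLp_fderiv i).coeFn_toLp] with x hx
    simp [hx]
  have h2 : ⟪(h.memLp_single i).toLp, G⟫_ℝ = ∫ x in Ω, G x i * φ x := by
    rw [L2.inner_def]
    refine integral_congr_ae ?_
    filter_upwards [(h.memLp_single i).coeFn_toLp] with x hx
    simp [hx, inner_smul_left, EuclideanSpace.inner_single_left, mul_comm]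
  rw [h1, h2, eq_neg_iff_add_eq_zero]

theorem isClosed_isWeakGradient :
    IsClosed {p : L2 Ω ℝ × L2 Ω (E N) | IsWeakGradient Ω p.1 p.2} := by
  simp only [isWeakGradient_iff, Set.ofPred_forall]
  exact isClosed_iInter fun φ => isClosed_iInter fun h => isClosed_iInter fun i =>
    isClosed_eq (by fun_prop) continuous_const

theorem IsWeakGradient.add_smul {u v : L2 Ω ℝ} {G H : L2 Ω (E N)} (hu : IsWeakGradient Ω u G)
    (hv : IsWeakGradient Ω v H) (a b : ℝ) :
    IsWeakGradient Ω (a • u + b • v) (a • G + b • H) := by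
  rw [isWeakGradient_iff] at *
  intro φ h i
  simp only [inner_add_right, inner_smul_right]
  linear_combination a * hu φ h i + b * hv φ h i

end WeakGradient

/-! ### Traces and the closed convex set of admissible pairs -/

section Trace

variable {N : ℕ} {Ω : Set (E N)}

/-- The smooth function `φ` is `ε`-close to `u`, its gradient to `G` and its boundary values to
`g`, all in `L²`. -/
structure IsApprox (Ω : Set (E N)) (u : L2 Ω ℝ) (G : L2 Ω (E N)) (g : frontier Ω → ℝ)
    (ε : ENNReal) (φ : E N → ℝ) : Prop where
  smooth : ContDiff ℝ ∞ φ
  value : eLpNorm (fun x => φ x - u x) 2 (volume.restrict Ω) ≤ ε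
  grad : eLpNorm (fun x => gradient φ x - G x) 2 (volume.restrict Ω) ≤ ε
  boundary : eLpNorm (fun y : frontier Ω => φ y - g y) 2 (surfaceMeasure Ω) ≤ ε

/-- Trading sequences for one approximant per `ε` makes limits and linear combinations free of
diagonal arguments. -/
theorem hasTrace_iff {u : L2 Ω ℝ} {g : frontier Ω → ℝ} :
    HasTrace Ω u g ↔ MemLp g 2 (surfaceMeasure Ω) ∧
      ∀ ε : ENNReal, ε ≠ 0 → ∃ φ, IsApprox Ω u (weakGradient Ω u) g ε φ := by
  refine and_congr_right fun _ => ⟨?_, fun h => ?_⟩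
  · rintro ⟨φ, hs, h1, h2, h3⟩ ε hε
    have key : ∀ {f : ℕ → ENNReal}, Tendsto f atTop (𝓝 0) → ∀ᶠ n in atTop, f n ≤ ε :=
      fun hf => hf.eventually_le_const (pos_iff_ne_zero.2 hε)
    obtain ⟨n, h1, h2, h3⟩ := ((key h1).and ((key h2).and (key h3))).exists
    exact ⟨φ n, hs n, h1, h2, h3⟩
  · have hpos : ∀ n : ℕ, ((n : ENNReal) + 1)⁻¹ ≠ 0 := fun n => by simp
    choose φ hφ using fun n : ℕ => h _ (hpos n)
    have hlim : Tendsto (fun n : ℕ => ((n : ENNReal) + 1)⁻¹) atTop (𝓝 0) := by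
      have := ENNReal.tendsto_inv_nat_nhds_zero.comp (tendsto_add_atTop_nat 1)
      refine this.congr fun n => by simp
    have key : ∀ {f : ℕ → ENNReal}, (∀ n : ℕ, f n ≤ ((n : ENNReal) + 1)⁻¹) →
        Tendsto f atTop (𝓝 0) := fun hf =>
      tendsto_of_tendsto_of_tendsto_of_le_of_le tendsto_const_nhds hlim (fun _ => zero_le) hf
    exact ⟨φ, fun n => (hφ n).smooth, key fun n => (hφ n).value, key fun n => (hφ n).grad,
      key fun n => (hφ n).boundary⟩

theorem continuous_gradient {φ : E N → ℝ} (h : ContDiff ℝ 1 φ) : Continuous (gradient φ) := by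
  unfold gradient
  exact (LinearIsometryEquiv.continuous _).comp (h.continuous_fderiv one_ne_zero)

theorem eLpNorm_add_smul_le {α F : Type*} [MeasurableSpace α] [NormedAddCommGroup F]
    [NormedSpace ℝ F] {μ : Measure α} {f h : α → F} (hf : AEStronglyMeasurable f μ)
    (hh : AEStronglyMeasurable h μ) {ε : ENNReal} (hfε : eLpNorm f 2 μ ≤ ε)
    (hhε : eLpNorm h 2 μ ≤ ε) {a b : ℝ} (ha : |a| ≤ 1) (hb : |b| ≤ 1) :
    eLpNorm (a • f + b • h) 2 μ ≤ 2 * ε := by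
  have key : ∀ {c : ℝ} {k : α → F}, |c| ≤ 1 → eLpNorm k 2 μ ≤ ε → eLpNorm (c • k) 2 μ ≤ ε := by
    intro c k hc hk
    rw [eLpNorm_const_smul]
    refine (mul_le_of_le_one_left (zero_le) ?_).trans hk
    rw [← enorm_one (G := ℝ), enorm_le_iff_norm_le]
    simpa using hc
  refine (eLpNorm_add_le (hf.const_smul a) (hh.const_smul b) (by norm_num)).trans ?_
  rw [two_mul]
  exact add_le_add (key ha hfε) (key hb hhε)

theorem IsApprox.aestronglyMeasurable {u : L2 Ω ℝ} {G : L2 Ω (E N)} {g : frontier Ω → ℝ}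
    {ε : ENNReal} {φ : E N → ℝ} (h : IsApprox Ω u G g ε φ)
    (hg : AEStronglyMeasurable g (surfaceMeasure Ω)) :
    AEStronglyMeasurable (fun x => φ x - u x) (volume.restrict Ω) ∧
    AEStronglyMeasurable (fun x => gradient φ x - G x) (volume.restrict Ω) ∧
    AEStronglyMeasurable (fun y : frontier Ω => φ y - g y) (surfaceMeasure Ω) :=
  ⟨h.smooth.continuous.aestronglyMeasurable.sub (Lp.aestronglyMeasurable u),
    (continuous_gradient (h.smooth.of_le (by simp))).aestronglyMeasurable.sub
      (Lp.aestronglyMeasurable G),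
    (h.smooth.continuous.comp continuous_subtype_val).aestronglyMeasurable.sub hg⟩

theorem IsApprox.add_smul {u v : L2 Ω ℝ} {G H : L2 Ω (E N)} {g k : frontier Ω → ℝ}
    {ε : ENNReal} {φ ψ : E N → ℝ} (h : IsApprox Ω u G g ε φ) (h' : IsApprox Ω v H k ε ψ)
    (hg : AEStronglyMeasurable g (surfaceMeasure Ω))
    (hk : AEStronglyMeasurable k (surfaceMeasure Ω)) {a b : ℝ} (ha : |a| ≤ 1) (hb : |b| ≤ 1) :
    IsApprox Ω (a • u + b • v) (a • G + b • H) (a • g + b • k) (2 * ε) (a • φ + b • ψ) where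
  smooth := (h.smooth.const_smul a).add (h'.smooth.const_smul b)
  value := by
    refine le_trans (eLpNorm_congr_ae ?_).le (eLpNorm_add_smul_le (h.aestronglyMeasurable hg).1
      (h'.aestronglyMeasurable hk).1 h.value h'.value ha hb)
    filter_upwards [Lp.coeFn_add (a • u) (b • v), Lp.coeFn_smul a u, Lp.coeFn_smul b v]
      with x h1 h2 h3
    simp only [h1, h2, h3, Pi.add_apply, Pi.smul_apply, smul_eq_mul]
    ring
  grad := by
    refine le_trans (eLpNorm_congr_ae ?_).le (eLpNorm_add_smul_le (h.aestronglyMeasurable hg).2.1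
      (h'.aestronglyMeasurable hk).2.1 h.grad h'.grad ha hb)
    filter_upwards [Lp.coeFn_add (a • G) (b • H), Lp.coeFn_smul a G, Lp.coeFn_smul b H]
      with x h1 h2 h3
    have hφ : DifferentiableAt ℝ φ x := (h.smooth.differentiable (by simp)).differentiableAt
    have hψ : DifferentiableAt ℝ ψ x := (h'.smooth.differentiable (by simp)).differentiableAt
    have hgr : gradient (a • φ + b • ψ) x = a • gradient φ x + b • gradient ψ x := by
      simp only [gradient]
      rw [fderiv_add (hφ.const_smul a) (hψ.const_smul b), fderiv_const_smul hφ,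
        fderiv_const_smul hψ]
      simp
    simp only [h1, h2, h3, hgr, Pi.add_apply, Pi.smul_apply]
    module
  boundary := by
    refine le_trans (eLpNorm_congr_ae (Eventually.of_forall fun y => ?_)).le
      (eLpNorm_add_smul_le (h.aestronglyMeasurable hg).2.2
      (h'.aestronglyMeasurable hk).2.2 h.boundary h'.boundary ha hb)
    simp only [Pi.add_apply, Pi.smul_apply, smul_eq_mul]
    ring

/-- Friedrichs' inequality for functions with zero trace. -/
theorem exists_enorm_le_of_zero_trace (hN : 1 ≤ N) (ho : IsOpen Ω)
    (hb : Bornology.IsBounded Ω) :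
    ∃ C : NNReal, ∀ (u : L2 Ω ℝ) (G : L2 Ω (E N)),
      (∀ ε : ENNReal, ε ≠ 0 → ∃ φ, IsApprox Ω u G 0 ε φ) → ‖u‖ₑ ≤ C * ‖G‖ₑ := by
  obtain ⟨C, hC⟩ := exists_eLpNorm_le hN ho hb
  refine ⟨C, fun u G h => ?_⟩
  have key : ∀ ε : ENNReal, ε ≠ 0 → ‖u‖ₑ ≤ C * ‖G‖ₑ + (1 + 2 * C) * ε := by
    intro ε hε
    obtain ⟨φ, hφ⟩ := h ε hε
    have hm := hφ.aestronglyMeasurable aestronglyMeasurable_const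
    have h1 : ‖u‖ₑ ≤ eLpNorm φ 2 (volume.restrict Ω) + ε := by
      rw [Lp.enorm_def]
      calc eLpNorm u 2 (volume.restrict Ω)
          = eLpNorm (φ - fun x => φ x - u x) 2 (volume.restrict Ω) := by
            congr 1; ext x; simp
        _ ≤ _ := eLpNorm_sub_le hφ.smooth.continuous.aestronglyMeasurable hm.1 (by norm_num)
        _ ≤ _ := by gcongr; exact hφ.value
    have h2 : eLpNorm (gradient φ) 2 (volume.restrict Ω) ≤ ε + ‖G‖ₑ := by
      rw [Lp.enorm_def]
      calc eLpNorm (gradient φ) 2 (volume.restrict Ω)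
          = eLpNorm ((fun x => gradient φ x - G x) + ⇑G) 2 (volume.restrict Ω) := by
            congr 1; ext x; simp
        _ ≤ _ := eLpNorm_add_le hm.2.1 (Lp.aestronglyMeasurable G) (by norm_num)
        _ ≤ _ := by gcongr; exact hφ.grad
    have h3 : eLpNorm (fun y : frontier Ω => φ y) 2 (surfaceMeasure Ω) ≤ ε := by
      simpa using hφ.boundary
    calc ‖u‖ₑ ≤ C * ((ε + ‖G‖ₑ) + ε) + ε := by
          refine h1.trans ?_
          gcongr
          refine (hC φ (hφ.smooth.of_le (by simp))).trans ?_
          gcongr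
      _ = _ := by ring
  refine ENNReal.le_of_forall_pos_le_add fun δ hδ _ => ?_
  have hc0 : (1 + 2 * C : ENNReal) ≠ 0 := by simp
  have hc1 : (1 + 2 * C : ENNReal) ≠ ⊤ := by finiteness
  -- This choice makes the total error exactly `δ`.
  refine (key (δ / (1 + 2 * C)) ?_).trans_eq ?_
  · simp [ENNReal.div_eq_zero_iff, hδ.ne', hc1]
  · rw [ENNReal.mul_div_cancel hc0 hc1]

/-- The pairs `(u, ∇u)` with `u ∈ H¹(Ω)`, `u ≥ 0` and trace `g`. -/
def admissiblePairs (Ω : Set (E N)) (g : frontier Ω → ℝ) : Set (L2 Ω ℝ × L2 Ω (E N)) :=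
  {p | 0 ≤ p.1 ∧ IsWeakGradient Ω p.1 p.2 ∧
    ∀ ε : ENNReal, ε ≠ 0 → ∃ φ, IsApprox Ω p.1 p.2 g ε φ}

theorem mem_admissible_iff {g : frontier Ω → ℝ}
    (hg : MemLp g 2 (surfaceMeasure Ω)) {u : L2 Ω ℝ} :
    u ∈ admissible Ω g ↔ (u, weakGradient Ω u) ∈ admissiblePairs Ω g := by
  simp only [admissible, admissiblePairs, Set.mem_ofPred_eq, hasTrace_iff]
  constructor
  · rintro ⟨h1, h2, h3⟩
    exact ⟨(Lp.coeFn_nonneg u).1 h2, isWeakGradient_weakGradient h1, h3.2⟩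
  · rintro ⟨h1, h2, h3⟩
    exact ⟨⟨_, h2⟩, (Lp.coeFn_nonneg u).2 h1, hg, h3⟩

/-- An `ε / 2`-approximant of a pair within `ε / 2` is an `ε`-approximant of the limit; the boundary
datum `g` is common to all pairs. -/
theorem isClosed_admissiblePairs (g : frontier Ω → ℝ) : IsClosed (admissiblePairs Ω g) := by
  refine (isClosed_le continuous_const continuous_fst).inter (isClosed_isWeakGradient.inter ?_)
  refine isClosed_of_closure_subset fun p hp ε hε => ?_
  have hε2 : ε / 2 ≠ 0 := by simp [ENNReal.div_eq_zero_iff, hε]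
  obtain ⟨q, hq, hpq⟩ := EMetric.mem_closure_iff.1 hp (ε / 2) (pos_iff_ne_zero.2 hε2)
  obtain ⟨φ, hφ⟩ := hq (ε / 2) hε2
  rw [Prod.edist_eq, max_lt_iff, edist_comm, edist_comm p.2, Lp.edist_def, Lp.edist_def] at hpq
  have hφm : AEStronglyMeasurable (fun x => φ x - q.1 x) (volume.restrict Ω) :=
    hφ.smooth.continuous.aestronglyMeasurable.sub (Lp.aestronglyMeasurable _)
  have hgm : AEStronglyMeasurable (fun x => gradient φ x - q.2 x) (volume.restrict Ω) :=
    (continuous_gradient (hφ.smooth.of_le (by simp))).aestronglyMeasurable.sub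
      (Lp.aestronglyMeasurable _)
  refine ⟨φ, hφ.smooth, ?_, ?_, hφ.boundary.trans ENNReal.half_le_self⟩
  · calc eLpNorm (fun x => φ x - p.1 x) 2 (volume.restrict Ω)
        = eLpNorm ((fun x => φ x - q.1 x) + (⇑q.1 - ⇑p.1)) 2 (volume.restrict Ω) := by
          congr 1; ext x; simp
      _ ≤ _ := eLpNorm_add_le hφm
          ((Lp.aestronglyMeasurable _).sub (Lp.aestronglyMeasurable _)) (by norm_num)
      _ ≤ ε / 2 + ε / 2 := add_le_add hφ.value hpq.1.le
      _ = ε := ENNReal.add_halves ε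
  · calc eLpNorm (fun x => gradient φ x - p.2 x) 2 (volume.restrict Ω)
        = eLpNorm ((fun x => gradient φ x - q.2 x) + (⇑q.2 - ⇑p.2)) 2 (volume.restrict Ω) := by
          congr 1; ext x; simp
      _ ≤ _ := eLpNorm_add_le hgm
          ((Lp.aestronglyMeasurable _).sub (Lp.aestronglyMeasurable _)) (by norm_num)
      _ ≤ ε / 2 + ε / 2 := add_le_add hφ.grad hpq.2.le
      _ = ε := ENNReal.add_halves ε

theorem exists_isApprox_add_smul {g k : frontier Ω → ℝ} (hg : MemLp g 2 (surfaceMeasure Ω))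
    (hk : MemLp k 2 (surfaceMeasure Ω)) {u v : L2 Ω ℝ} {G H : L2 Ω (E N)}
    (hu : ∀ ε : ENNReal, ε ≠ 0 → ∃ φ, IsApprox Ω u G g ε φ)
    (hv : ∀ ε : ENNReal, ε ≠ 0 → ∃ φ, IsApprox Ω v H k ε φ) {a b : ℝ} (ha : |a| ≤ 1)
    (hb : |b| ≤ 1) (ε : ENNReal) (hε : ε ≠ 0) :
    ∃ φ, IsApprox Ω (a • u + b • v) (a • G + b • H) (a • g + b • k) ε φ := by
  have hε2 : ε / 2 ≠ 0 := by simp [ENNReal.div_eq_zero_iff, hε]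
  obtain ⟨φ, hφ⟩ := hu _ hε2
  obtain ⟨ψ, hψ⟩ := hv _ hε2
  have := hφ.add_smul hψ hg.1 hk.1 ha hb
  rw [ENNReal.mul_div_cancel two_ne_zero ENNReal.ofNat_ne_top] at this
  exact ⟨_, this⟩

theorem convex_admissiblePairs {g : frontier Ω → ℝ} (hg : MemLp g 2 (surfaceMeasure Ω)) :
    Convex ℝ (admissiblePairs Ω g) := by
  rintro ⟨u, G⟩ ⟨hu0, hu1, hu2⟩ ⟨v, H⟩ ⟨hv0, hv1, hv2⟩ a b ha hb hab
  refine ⟨?_, hu1.add_smul hv1 a b, ?_⟩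
  · change 0 ≤ a • u + b • v
    rw [← Lp.coeFn_nonneg] at hu0 hv0 ⊢
    filter_upwards [hu0, hv0, Lp.coeFn_add (a • u) (b • v), Lp.coeFn_smul a u, Lp.coeFn_smul b v]
      with x h1 h2 h3 h4 h5
    simp only [h3, h4, h5, Pi.add_apply, Pi.smul_apply, smul_eq_mul, Pi.zero_apply] at h1 h2 ⊢
    positivity
  · have h := exists_isApprox_add_smul hg hg hu2 hv2 (a := a) (b := b)
      (by rw [abs_of_nonneg ha]; linarith) (by rw [abs_of_nonneg hb]; linarith)
    rw [← _root_.add_smul, hab, one_smul] at h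
    exact h

theorem norm_le_mul_of_enorm_le_mul {X Y : Type*} [NormedAddCommGroup X] [NormedAddCommGroup Y]
    {C : NNReal} {x : X} {y : Y} (h : ‖x‖ₑ ≤ C * ‖y‖ₑ) : ‖x‖ ≤ C * ‖y‖ := by
  rw [enorm_eq_nnnorm, enorm_eq_nnnorm] at h
  exact_mod_cast h

/-- Subtracting approximants cancels `g`, so the difference falls under the zero-trace inequality.
-/
theorem exists_norm_sub_le (hN : 1 ≤ N) (ho : IsOpen Ω) (hb : Bornology.IsBounded Ω)
    {g : frontier Ω → ℝ} (hg : MemLp g 2 (surfaceMeasure Ω)) :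
    ∃ C : NNReal, ∀ p ∈ admissiblePairs Ω g, ∀ q ∈ admissiblePairs Ω g,
      ‖p.1 - q.1‖ ≤ C * ‖p.2 - q.2‖ := by
  obtain ⟨C, hC⟩ := exists_enorm_le_of_zero_trace hN ho hb
  refine ⟨C, fun p hp q hq => norm_le_mul_of_enorm_le_mul (hC _ _ fun ε hε => ?_)⟩
  have h := exists_isApprox_add_smul hg hg hp.2.2 hq.2.2 (a := 1) (b := -1) (by simp) (by simp)
    ε hε
  have e₁ : (1 : ℝ) • p.1 + (-1 : ℝ) • q.1 = p.1 - q.1 := by module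
  have e₂ : (1 : ℝ) • p.2 + (-1 : ℝ) • q.2 = p.2 - q.2 := by module
  have e₃ : (1 : ℝ) • g + (-1 : ℝ) • g = 0 := by module
  rwa [e₁, e₂, e₃] at h

end Trace

/-! ### The energy on nonnegative functions, and the conclusion -/

theorem energy_eq {N : ℕ} {Ω : Set (E N)} {f : E N → ℝ} (hf : MemLp f 2 (volume.restrict Ω))
    {u : L2 Ω ℝ} (hu : 0 ≤ u) :
    energy Ω f u = 1 / 2 * ‖weakGradient Ω u‖ ^ 2 - ⟪hf.toLp f, u⟫_ℝ := by
  unfold energy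
  congr 1
  · rw [← real_inner_self_eq_norm_sq, L2.inner_def]
    simp only [real_inner_self_eq_norm_sq]
  · rw [L2.inner_def]
    refine integral_congr_ae ?_
    filter_upwards [hf.coeFn_toLp, (Lp.coeFn_nonneg u).2 hu] with x h1 h2
    rw [max_eq_left (show 0 ≤ u x from h2), h1]
    simp [mul_comm]

end ObstacleEnergy

end

theorem lemma2p1 (N : ℕ) (hN : 1 ≤ N) (Ω : Set (ObstacleEnergy.E N))
    (hΩ : ObstacleEnergy.IsBoundedLipschitzDomain Ω)
    (g : frontier Ω → ℝ) (hS : (ObstacleEnergy.admissible Ω g).Nonempty)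
    (f : ObstacleEnergy.E N → ℝ) (hf : MemLp f 2 (volume.restrict Ω)) :
    ∃! u : ObstacleEnergy.L2 Ω ℝ, u ∈ ObstacleEnergy.admissible Ω g ∧
      ∀ v ∈ ObstacleEnergy.admissible Ω g,
        ObstacleEnergy.energy Ω f u ≤ ObstacleEnergy.energy Ω f v := by
  open ObstacleEnergy in
  have ho := hΩ.isOpen
  obtain ⟨u₀, hu₀⟩ := hS
  have hg : MemLp g 2 (surfaceMeasure Ω) := hu₀.2.2.1
  have hmem : ∀ {u : L2 Ω ℝ}, u ∈ admissible Ω g ↔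
    (u, weakGradient Ω u) ∈ admissiblePairs Ω g := mem_admissible_iff hg
  have hE : ∀ {u : L2 Ω ℝ}, u ∈ admissible Ω g → energy Ω f u =
      1 / 2 * ‖weakGradient Ω u‖ ^ 2 - ⟪hf.toLp f, u⟫_ℝ := fun hu => energy_eq hf (hmem.1 hu).1
  obtain ⟨C, hC⟩ := exists_norm_sub_le hN ho hΩ.isBounded hg
  obtain ⟨⟨u, G⟩, ⟨hu, hmin⟩, huniq⟩ := existsUnique_minimizer ⟨_, hmem.1 hu₀⟩
    (isClosed_admissiblePairs g) (convex_admissiblePairs hg) C.coe_nonneg hC (hf.toLp f)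
  -- Uniqueness of the weak gradient makes the minimizing pair the one attached to `u`.
  obtain rfl : weakGradient Ω u = G := weakGradient_eq ho hu.2.1
  refine ⟨u, ⟨hmem.2 hu, fun v hv => ?_⟩, ?_⟩
  · rw [hE (hmem.2 hu), hE hv]
    have h := hmin (v, weakGradient Ω v) (hmem.1 hv)
    dsimp only at h
    exact h
  · rintro v ⟨hv, hvmin⟩
    refine congrArg Prod.fst (huniq (v, weakGradient Ω v) ⟨hmem.1 hv, fun q hq => ?_⟩)
    have hGq : weakGradient Ω q.1 = q.2 := weakGradient_eq ho hq.2.1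
    have hq' : q.1 ∈ admissible Ω g := hmem.2 (by rw [hGq]; exact hq)
    have := hvmin _ hq'
    rwa [hE hv, hE hq', hGq] at this
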